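/- Let $d\in\mathbb N$, let $\mathcal A$ be a nonempty compact set of real $d\times d$ matrices, all of whose elements have only real eigenvalues, and let $\varepsilon>0$. Notation. A trajectory of $\mathcal A$ is a locally absolutely continuous function $x:[0,\infty)\to\mathbb R^d$ such that $\dot x(t)=A(t)x(t)$ for almost every $t\ge 0$, for some measurable $A:[0,\infty)\to\mathcal A$. The Lyapunov exponent $\sigma(\mathcal A)\in[-\infty,+\infty]$ is the infimum of all $\alpha\in\mathbb R$ such that for every trajectory $x$ there is a constant $C$ with $\|x(t)\|\le Ce^{\alpha t}$ for all $t\ge0$. The joint spectral radius of a set $\mathcal M$ of matrices is $\rho(\mathcal M)=\lim_{k\to\infty}\sup_{A_1,\dots,A_k\in\mathcal M}\|A_1\cdots A_k\|^{1/k}$, and $I+\tau\mathcal A=\{I+\tau A: A\in\mathcal A\}$. Put $$K(\mathcal A,\varepsilon)=\begin{cases}+\infty,&\sigma(\mathcal A)\ge-\varepsilon,\\ \sup\{\tau>0:\rho(I+\tau\mathcal A)<1\},&\sigma(\mathcal A)<-\varepsilon.\end{cases}$$ For a finite multiset $h$ of real numbers let $\mathcal P_h$ be the real linear span of the functions $t^je^{-at}$,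 where $a$ runs over the elements of $h$ and $0\le j<$ the multiplicity of $a$ in $h$. Let $$\kappa(h,\varepsilon)=\inf\Big\{\frac{1-p(0)}{p'(0)-\varepsilon p(0)}\ :\ p\in\mathcal P_h,\ \sup_{t\ge0}|p(t)|\le1,\ p'(0)>\varepsilon p(0)\Big\},$$ with $\inf\emptyset=+\infty$. For a matrix $A$ with real spectrum, $-\mathrm{sp}(A)-\varepsilon\mathbf e$ denotes the multiset of the numbers $-\lambda-\varepsilon$, where $\lambda$ runs over the eigenvalues of $A$ counted with algebraic multiplicity. Then $\kappa(-\mathrm{sp}(A)-\varepsilon\mathbf e,\varepsilon)$ attains its minimum over $A\in\mathcal A$, and $$K(\mathcal A,\varepsilon)\ \ge\ \min_{A\in\mathcal A}\kappa(-\mathrm{sp}(A)-\varepsilon\mathbf e,\varepsilon).$$ -/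

import Mathlib

open Filter MeasureTheory
open scoped ENNReal

noncomputable section

namespace LSS

/-- All (complex) eigenvalues of the real matrix `A` are real. -/
def HasRealSpectrum {d : ℕ} (A : Matrix (Fin d) (Fin d) ℝ) : Prop :=
  ∀ z ∈ spectrum ℂ (A.map (algebraMap ℝ ℂ)), z.im = 0

/-- The real eigenvalues of `A`, counted with (algebraic) multiplicity. For a matrix with real
spectrum this is the whole spectrum, a multiset with `d` elements. -/
def sp {d : ℕ} (A : Matrix (Fin d) (Fin d) ℝ) : Multiset ℝ :=
  A.charpoly.roots

/-- `x` is a trajectory of the linear switching system `x' = A(t) x`, `A(t) ∈ 𝒜`, `t ≥ 0`: there is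
a measurable switching law `A` with values in `𝒜` such that `x` is (locally) absolutely continuous
on `[0, ∞)` and satisfies the equation for almost every `t ≥ 0`. -/
def IsTrajectory {d : ℕ} (𝒜 : Set (Matrix (Fin d) (Fin d) ℝ))
    (x : ℝ → EuclideanSpace ℝ (Fin d)) : Prop :=
  ∃ A : ℝ → Matrix (Fin d) (Fin d) ℝ,
    (∀ i j, Measurable fun t => A t i j) ∧
    (∀ t, 0 ≤ t → A t ∈ 𝒜) ∧
    (∀ T, 0 ≤ T → AbsolutelyContinuousOnInterval x 0 T) ∧
    (∀ᵐ t ∂(volume : Measure ℝ), 0 ≤ t →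
      HasDerivAt x (Matrix.toEuclideanCLM (𝕜 := ℝ) (A t) (x t)) t)

/-- The worst-case Lyapunov exponent `σ(𝒜)`: the infimum of all real `α` such that every
trajectory satisfies `‖x(t)‖ ≤ C e^{α t}` on `[0, ∞)` for some constant `C` (which may depend on the
trajectory). -/
def lyapunovExponent {d : ℕ} (𝒜 : Set (Matrix (Fin d) (Fin d) ℝ)) : EReal :=
  sInf (Real.toEReal '' {α : ℝ | ∀ x : ℝ → EuclideanSpace ℝ (Fin d), IsTrajectory 𝒜 x →
    ∃ C : ℝ, ∀ t, 0 ≤ t → ‖x t‖ ≤ C * Real.exp (α * t)})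

/-- The joint spectral radius
`ρ(ℳ) = lim_{k → ∞} sup_{A₁, …, A_k ∈ ℳ} ‖A₁ ⋯ A_k‖^{1/k}`, with the Euclidean operator norm.
For nonempty bounded `ℳ` the limit exists, so it equals the upper limit taken here. -/
def jointSpectralRadius {d : ℕ} (ℳ : Set (Matrix (Fin d) (Fin d) ℝ)) : ℝ≥0∞ :=
  limsup (fun k : ℕ =>
    ⨆ (A : Fin k → Matrix (Fin d) (Fin d) ℝ) (_ : ∀ i, A i ∈ ℳ),
      ‖Matrix.toEuclideanCLM (𝕜 := ℝ) (List.ofFn A).prod‖ₑ ^ (1 / (k : ℝ))) atTop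

/-- The family `I + τ 𝒜 = {I + τ A | A ∈ 𝒜}` of the Euler discretization with step `τ`. -/
def eulerFamily {d : ℕ} (𝒜 : Set (Matrix (Fin d) (Fin d) ℝ)) (τ : ℝ) :
    Set (Matrix (Fin d) (Fin d) ℝ) :=
  (fun A => 1 + τ • A) '' 𝒜

open Classical in
/-- The individual maximal step size: `K(𝒜, ε) = +∞` if `σ(𝒜) ≥ -ε`, and
`K(𝒜, ε) = sup {τ > 0 | ρ(I + τ 𝒜) < 1}` if `σ(𝒜) < -ε`. -/
def maxStep {d : ℕ} (𝒜 : Set (Matrix (Fin d) (Fin d) ℝ)) (ε : ℝ) : EReal :=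
  if ((-ε : ℝ) : EReal) ≤ lyapunovExponent 𝒜 then ⊤
  else sSup (Real.toEReal '' {τ : ℝ | 0 < τ ∧ jointSpectralRadius (eulerFamily 𝒜 τ) < 1})

/-- The space `𝒫_h` of exponential polynomials with exponents `h` (with multiplicities): the real
span of the functions `t ^ j * e^{-a t}`, where `a` is an entry of `h` and `j` is smaller than the
multiplicity of `a` in `h`. -/
def expPoly (h : Multiset ℝ) : Submodule ℝ (ℝ → ℝ) :=
  Submodule.span ℝ {f | ∃ a ∈ h, ∃ j < h.count a, f = fun t => t ^ j * Real.exp (-(a * t))}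

/-- `κ(h, ε)`: the infimum of `(1 - p(0)) / (p'(0) - ε p(0))` over all `p ∈ 𝒫_h` with
`|p| ≤ 1` on `[0, ∞)` and `p'(0) > ε p(0)` (with value `+∞` if there is no such `p`). -/
def kappa (h : Multiset ℝ) (ε : ℝ) : EReal :=
  sInf {v | ∃ p ∈ expPoly h, (∀ t, 0 ≤ t → |p t| ≤ 1) ∧ ε * p 0 < deriv p 0 ∧
    v = (((1 - p 0) / (deriv p 0 - ε * p 0) : ℝ) : EReal)}

/-- The shifted spectrum `h = -sp(A) - ε 𝐞`. -/
def shiftedSpectrum {d : ℕ} (A : Matrix (Fin d) (Fin d) ℝ) (ε : ℝ) : Multiset ℝ :=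
  (sp A).map fun μ => -μ - ε

end LSS

end

/-! If `σ(𝒜) < -ε`, the semigroup generated by the flows `e^{t(A + ε)}`, `A ∈ 𝒜`, is bounded:
otherwise some vector has an unbounded orbit, and concatenating flows along it yields one trajectory
too large for the exponent (`exists_norm_le_of_mem_flowSemigroup`). Let `S` be the closure of this
semigroup and `|x| = sup_{s ∈ S} ‖s x‖`, a norm that no flow `e^{t(A + ε)}`, `t ≥ 0`, increases.

For `|x| ≤ 1`, `‖u‖ ≤ 1` and `s ∈ S`, the function `p(t) = ⟨u, s e^{t(A + ε)} x⟩` lies in `𝒫_h` with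
`h = -sp(A) - ε`, is bounded by one on the half-line, and satisfies `p'(0) - ε p(0) = ⟨u, s A x⟩`.
By the definition of `κ`, a step `0 < τ < κ` gives `⟨u, s (x + τ A x)⟩ < 1` (`inner_euler_lt_one`).
Compactness makes the bound uniform: every Euler step contracts `|·|` by one factor `q < 1`, so `ρ(I
+ τ𝒜) < 1`.

For the minimum, the functions `t^j e^{-at}` are a poor basis, since they jump when eigenvalues
merge. Matrix coefficients of the flow of the companion matrix parametrize `𝒫_h` continuously in the
coefficients of the characteristic polynomial (`mem_expPoly_iff_companionFun`). The pairs of a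
matrix and a bounded function then form a compact set (`isCompact_boundedPairs`), on which the
quotient is minimized. -/

open Polynomial in
theorem Matrix.charpoly_splits_of_hasRealSpectrum {d : ℕ} {A : Matrix (Fin d) (Fin d) ℝ}
    (hA : LSS.HasRealSpectrum A) : A.charpoly.Splits := by
  have hs : (A.charpoly.map (algebraMap ℝ ℂ)).Splits := IsAlgClosed.splits _
  refine hs.of_splits_map_of_injective (algebraMap ℝ ℂ).injective fun z hz => ?_
  rw [mem_roots', ← Matrix.charpoly_map] at hz
  have hz' : z ∈ spectrum ℂ (A.map (algebraMap ℝ ℂ)) :=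
    Matrix.mem_spectrum_iff_isRoot_charpoly.2 hz.2
  exact ⟨z.re, Complex.ext rfl (by simp [hA z hz'])⟩

namespace LSS

/-! ### Exponential polynomials as matrix coefficients of linear flows -/

theorem exp_mem_expPoly {h : Multiset ℝ} {a : ℝ} (ha : a ∈ h) :
    (fun t : ℝ => Real.exp (-(a * t))) ∈ expPoly h :=
  Submodule.subset_span ⟨a, ha, 0, Multiset.count_pos.2 ha, by simp⟩

theorem pow_mul_exp_mem_expPoly {h : Multiset ℝ} {a : ℝ} {j : ℕ} (hj : j < h.count a) :
    (fun t : ℝ => t ^ j * Real.exp (-(a * t))) ∈ expPoly h :=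
  Submodule.subset_span ⟨a, Multiset.count_pos.1 (by omega), j, hj, rfl⟩

theorem hasDerivAt_pow_mul_exp (a : ℝ) (j : ℕ) (t : ℝ) :
    HasDerivAt (fun t : ℝ => t ^ j * Real.exp (-(a * t)))
      (j * t ^ (j - 1) * Real.exp (-(a * t)) - a * (t ^ j * Real.exp (-(a * t)))) t := by
  have h := (hasDerivAt_pow j t).mul (((hasDerivAt_id t).const_mul a).neg.exp)
  refine HasDerivAt.congr_deriv (h) ?_
  simp
  ring

/-- The equation `f' + a f = g` with `g` an exponential polynomial has a solution which is an
exponential polynomial, the multiplicity of the exponent `a` growing by one. -/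
theorem exists_hasDerivAt_of_mem_expPoly (h : Multiset ℝ) (a : ℝ) {g : ℝ → ℝ}
    (hg : g ∈ expPoly h) :
    ∃ f ∈ expPoly (a ::ₘ h), ∀ t, HasDerivAt f (g t - a * f t) t := by
  induction hg using Submodule.span_induction with
  | zero => exact ⟨0, zero_mem _, fun t => by simp⟩
  | add x y _ _ hx hy =>
    obtain ⟨f₁, h₁, h₁'⟩ := hx
    obtain ⟨f₂, h₂, h₂'⟩ := hy
    refine ⟨f₁ + f₂, add_mem h₁ h₂, fun t => ?_⟩
    refine HasDerivAt.congr_deriv ((h₁' t).add (h₂' t)) ?_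
    simp only [Pi.add_apply]
    ring
  | smul c x _ hx =>
    obtain ⟨f, h₁, h₁'⟩ := hx
    refine ⟨c • f, Submodule.smul_mem _ _ h₁, fun t => ?_⟩
    refine HasDerivAt.congr_deriv ((h₁' t).const_smul c) ?_
    simp only [Pi.smul_apply, smul_eq_mul]
    ring
  | mem x hx =>
    obtain ⟨b, -, j, hj, rfl⟩ := hx
    rcases eq_or_ne b a with rfl | hab
    -- Resonance: integration raises the power of `t` by one, which the extra copy of the exponent
    -- allows.
    · refine ⟨fun t => ((j : ℝ) + 1)⁻¹ * (t ^ (j + 1) * Real.exp (-(b * t))),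
        Submodule.smul_mem _ _ (pow_mul_exp_mem_expPoly (by simpa using hj)), fun t => ?_⟩
      refine HasDerivAt.congr_deriv ((hasDerivAt_pow_mul_exp b (j + 1) t).const_mul ((j : ℝ) + 1)⁻¹) ?_
      have : (j : ℝ) + 1 ≠ 0 := by positivity
      push_cast
      field_simp
    · have hab' : a - b ≠ 0 := sub_ne_zero.2 hab.symm
      induction j with
      | zero =>
        refine ⟨fun t => (a - b)⁻¹ * (t ^ 0 * Real.exp (-(b * t))),
          Submodule.smul_mem _ _ (pow_mul_exp_mem_expPoly
            (hj.trans_le (Multiset.count_le_count_cons b a h))), fun t => ?_⟩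
        refine HasDerivAt.congr_deriv ((hasDerivAt_pow_mul_exp b 0 t).const_mul (a - b)⁻¹) ?_
        field_simp
        simp
      | succ j ih =>
        obtain ⟨f, hf, hf'⟩ := ih (by omega)
        -- Applying `d/dt + a` to `t^(j+1) e^{-bt}` gives `(a - b)` times it plus `(j + 1) t^j
        -- e^{-bt}`; the solution for the lower power removes the second term.
        refine ⟨fun t => (a - b)⁻¹ * (t ^ (j + 1) * Real.exp (-(b * t)))
            - ((a - b)⁻¹ * (j + 1)) * f t, ?_, fun t => ?_⟩
        · exact sub_mem (Submodule.smul_mem _ _ (pow_mul_exp_mem_expPoly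
            (hj.trans_le (Multiset.count_le_count_cons b a h)))) (Submodule.smul_mem _ _ hf)
        · refine HasDerivAt.congr_deriv (((hasDerivAt_pow_mul_exp b (j + 1) t).const_mul (a - b)⁻¹).sub
            ((hf' t).const_mul ((a - b)⁻¹ * (j + 1)))) ?_
          push_cast
          field_simp
          ring

/-- A solution of `f' = -a f` on the whole line is a multiple of `e^{-at}`. -/
theorem eq_mul_exp_of_hasDerivAt {f : ℝ → ℝ} {a : ℝ} (hf : ∀ t, HasDerivAt f (-(a * f t)) t)
    (t : ℝ) : f t = f 0 * Real.exp (-(a * t)) := by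
  have h : ∀ t, HasDerivAt (fun t => f t * Real.exp (a * t)) 0 t := fun t => by
    refine HasDerivAt.congr_deriv ((hf t).mul (((hasDerivAt_id t).const_mul a).exp)) ?_
    simp
    ring
  have h0 := is_const_of_deriv_eq_zero (fun t => (h t).differentiableAt) (fun t => (h t).deriv) t 0
  simp only [mul_zero, Real.exp_zero, mul_one] at h0
  rw [← h0, mul_assoc, ← Real.exp_add]
  simp

section Flow

variable {V : Type*} [NormedAddCommGroup V] [NormedSpace ℝ V] [CompleteSpace V]

theorem hasDerivAt_exp_smul_apply (M : V →L[ℝ] V) (y : V) (t : ℝ) :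
    HasDerivAt (fun t : ℝ => NormedSpace.exp (t • M) y) (NormedSpace.exp (t • M) (M y)) t :=
  (hasDerivAt_exp_smul_const (𝕂 := ℝ) M t).clm_apply (hasDerivAt_const t y) |>.congr_deriv (by simp)

theorem hasDerivAt_exp_smul_apply' (M : V →L[ℝ] V) (y : V) (t : ℝ) :
    HasDerivAt (fun t : ℝ => NormedSpace.exp (t • M) y) (M (NormedSpace.exp (t • M) y)) t :=
  (hasDerivAt_exp_smul_const' (𝕂 := ℝ) M t).clm_apply (hasDerivAt_const t y) |>.congr_deriv
    (by simp)

open Polynomial in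
/-- Matrix coefficients of the flow `e^{tM}` along a vector annihilated by `∏ (M + a)` are
exponential polynomials. -/
theorem apply_exp_smul_mem_expPoly (M : V →L[ℝ] V) (φ : V →L[ℝ] ℝ) (h : Multiset ℝ) (y : V)
    (hy : aeval M (h.map fun a => X + C a).prod y = 0) :
    (fun t : ℝ => φ (NormedSpace.exp (t • M) y)) ∈ expPoly h := by
  induction h using Multiset.induction_on generalizing y with
  | empty =>
    have : y = 0 := by simpa using hy
    subst this
    simp only [map_zero]
    exact (expPoly 0).zero_mem
  | cons a h ih =>
    -- Splitting off the factor `X + a`: the vector `My + ay` is annihilated by the remaining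
    -- product, and the coefficient `g` along `y` satisfies `g' + a g = φ(e^{tM}(My + ay))`.
    have hM : aeval M (h.map fun a => X + C a).prod (M y + a • y) = 0 := by
      rw [Multiset.map_cons, Multiset.prod_cons, mul_comm, map_mul] at hy
      simpa [Algebra.algebraMap_eq_smul_one] using hy
    obtain ⟨f, hf, hf'⟩ := exists_hasDerivAt_of_mem_expPoly h a (ih _ hM)
    set g : ℝ → ℝ := fun t => φ (NormedSpace.exp (t • M) y) with hg
    have hgd : ∀ t, HasDerivAt g (φ (NormedSpace.exp (t • M) (M y))) t := fun t =>
      φ.hasFDerivAt.comp_hasDerivAt t (hasDerivAt_exp_smul_apply M y t)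
    have hfg := eq_mul_exp_of_hasDerivAt (f := g - f) (a := a) fun t => by
      refine HasDerivAt.congr_deriv ((hgd t).sub (hf' t)) ?_
      simp [hg]
      ring
    have : g = f + (g 0 - f 0) • fun t : ℝ => Real.exp (-(a * t)) := by
      ext t
      have := hfg t
      simp only [Pi.sub_apply, Pi.add_apply, Pi.smul_apply, smul_eq_mul] at this ⊢
      linarith
    rw [this]
    exact add_mem hf (Submodule.smul_mem _ _ (exp_mem_expPoly (by simp)))

end Flow

/-! ### Companion coordinates on the space of exponential polynomials -/

theorem finite_finrank_expPoly_le (h : Multiset ℝ) :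
    FiniteDimensional ℝ (expPoly h) ∧ Module.finrank ℝ (expPoly h) ≤ h.card := by
  classical
  set s : Finset (ℝ → ℝ) := (h.toFinset.sigma fun a => Finset.range (h.count a)).image
    fun x => fun t : ℝ => t ^ x.2 * Real.exp (-(x.1 * t)) with hs
  have hsp : expPoly h = Submodule.span ℝ (s : Set (ℝ → ℝ)) := by
    unfold expPoly
    congr 1
    ext f
    simp only [hs, Finset.coe_image, Set.mem_image, Finset.mem_coe, Finset.mem_sigma,
      Multiset.mem_toFinset, Finset.mem_range, Set.mem_ofPred_eq]
    constructor
    · rintro ⟨a, ha, j, hj, rfl⟩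
      exact ⟨⟨a, j⟩, ⟨ha, hj⟩, rfl⟩
    · rintro ⟨⟨a, j⟩, ⟨ha, hj⟩, rfl⟩
      exact ⟨a, ha, j, hj, rfl⟩
  rw [hsp]
  refine ⟨FiniteDimensional.span_finset ℝ s, (finrank_span_finset_le_card s).trans ?_⟩
  refine Finset.card_image_le.trans ?_
  simp [Finset.card_sigma]

/-- The companion matrix of a monic polynomial of degree `n + 1`: multiplication by `X` in the
basis `1, X, …, X ^ n`. -/
def companion (n : ℕ) (q : Polynomial ℝ) : Matrix (Fin (n + 1)) (Fin (n + 1)) ℝ :=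
  Matrix.of fun i j => if j = Fin.last n then -q.coeff i else if (i : ℕ) = j + 1 then 1 else 0

/-- The companion matrix as an operator of the Euclidean space. -/
noncomputable def companionCLM (n : ℕ) (q : Polynomial ℝ) :
    EuclideanSpace ℝ (Fin (n + 1)) →L[ℝ] EuclideanSpace ℝ (Fin (n + 1)) :=
  Matrix.toEuclideanCLM (𝕜 := ℝ) (companion n q)

section Companion

variable {n : ℕ} {q : Polynomial ℝ}

theorem companionCLM_single (j : Fin (n + 1)) (i : Fin (n + 1)) :
    companionCLM n q (EuclideanSpace.single j 1) i = companion n q i j := by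
  simp [companionCLM, Matrix.ofLp_toEuclideanCLM]

theorem companionCLM_pow_single (k : ℕ) (hk : k < n + 1) :
    (companionCLM n q ^ k) (EuclideanSpace.single 0 1) = EuclideanSpace.single ⟨k, hk⟩ 1 := by
  induction k with
  | zero => rfl
  | succ k ih =>
    rw [pow_succ', mul_apply_eq_comp, ih (by omega)]
    ext i
    rw [companionCLM_single]
    have : k ≠ n := by omega
    simp [companion, this, Fin.ext_iff]

theorem aeval_companionCLM (hq : q.Monic) (hd : q.natDegree = n + 1) :
    Polynomial.aeval (companionCLM n q) q (EuclideanSpace.single 0 1) = 0 := by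
  have hl : q.coeff (n + 1) = 1 := by rw [← hd]; exact hq
  rw [Polynomial.aeval_eq_sum_range, hd, Finset.sum_range_succ, hl, one_smul,
    add_apply, sum_apply, pow_succ',
    mul_apply_eq_comp, companionCLM_pow_single n (by omega), Finset.sum_range]
  ext i
  have h1 : ∀ k : Fin (n + 1), (q.coeff k • companionCLM n q ^ (k : ℕ))
      (EuclideanSpace.single 0 1) = q.coeff k • EuclideanSpace.single k 1 := fun k => by
    rw [smul_apply, companionCLM_pow_single k k.2]
  rw [Finset.sum_congr rfl fun k _ => h1 k, PiLp.add_apply, companionCLM_single]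
  simp [companion, Fin.last, Pi.single_apply]

/-- The function `t ↦ ⟨v, e^{tC} e₀⟩`, where `C` is the companion operator of `q`. -/
noncomputable def companionFun (q : Polynomial ℝ) (v : EuclideanSpace ℝ (Fin (n + 1))) (t : ℝ) :
    ℝ :=
  inner ℝ v (NormedSpace.exp (t • companionCLM n q) (EuclideanSpace.single 0 1))

theorem hasDerivAt_inner_exp_smul {V : Type*} [NormedAddCommGroup V] [InnerProductSpace ℝ V]
    [CompleteSpace V] (M : V →L[ℝ] V) (v y : V) (t : ℝ) :
    HasDerivAt (fun t : ℝ => inner ℝ v (NormedSpace.exp (t • M) y))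
      (inner ℝ v (NormedSpace.exp (t • M) (M y))) t :=
  (innerSL ℝ v).hasFDerivAt.comp_hasDerivAt t (hasDerivAt_exp_smul_apply M y t)

/-- Differentiating repeatedly makes `v` orthogonal to `e^{tC} C^k e₀` for all `k`. The vectors `C^k
e₀` run through the standard basis and `e^{tC}` is invertible, so `v` is orthogonal to everything.
-/
theorem eq_zero_of_companionFun_eq_zero {v : EuclideanSpace ℝ (Fin (n + 1))}
    (hv : ∀ t, 0 ≤ t → companionFun q v t = 0) : v = 0 := by
  set M := companionCLM n q with hM
  set e : EuclideanSpace ℝ (Fin (n + 1)) := EuclideanSpace.single 0 1 with he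
  -- Vanishing is known only on the half-line, so `t > 0` is needed for two-sided derivatives.
  have key : ∀ k : ℕ, ∀ t : ℝ, 0 < t → inner ℝ v (NormedSpace.exp (t • M) ((M ^ k) e)) = 0 := by
    intro k
    induction k with
    | zero => exact fun t ht => hv t ht.le
    | succ k ih =>
      intro t ht
      have h1 := hasDerivAt_inner_exp_smul M v ((M ^ k) e) t
      have h2 : (fun t : ℝ => inner ℝ v (NormedSpace.exp (t • M) ((M ^ k) e))) =ᶠ[nhds t]
          fun _ => 0 := by
        filter_upwards [lt_mem_nhds ht] with s hs using ih s hs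
      rw [pow_succ', mul_apply_eq_comp]
      exact h1.unique ((hasDerivAt_const t (0 : ℝ)).congr_of_eventuallyEq h2)
  have h3 : ∀ w, inner ℝ v (NormedSpace.exp M w) = 0 := by
    intro w
    have hw : w = ∑ i, w i • EuclideanSpace.single i (1 : ℝ) := by
      ext j
      simp [Pi.single_apply]
    rw [hw, map_sum, inner_sum]
    refine Finset.sum_eq_zero fun i _ => ?_
    have := key i 1 one_pos
    rw [hM, companionCLM_pow_single i i.2, one_smul] at this
    rw [map_smul, inner_smul_right, this, mul_zero]
  have h4 := h3 (NormedSpace.exp (-M) v)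
  have h5 : NormedSpace.exp M * NormedSpace.exp (-M) = 1 := by
    let _ : NormedAlgebra ℚ (EuclideanSpace ℝ (Fin (n + 1)) →L[ℝ] EuclideanSpace ℝ (Fin (n + 1))) :=
      NormedAlgebra.restrictScalars ℚ ℝ _
    rw [← NormedSpace.exp_add_of_commute (Commute.neg_right (Commute.refl M)), add_neg_cancel,
      NormedSpace.exp_zero]
  rw [← mul_apply_eq_comp, h5, one_apply_eq_self] at h4
  exact inner_self_eq_zero.1 h4

/-- A dimension count: `v ↦ companionFun q v` is injective from a space of dimension `n + 1` into
`expPoly h`, because `q(C) e₀ = 0`, and `expPoly h` has dimension at most `h.card = n + 1`. -/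
theorem mem_expPoly_iff_companionFun {h : Multiset ℝ}
    (hq : q = (h.map fun a => Polynomial.X + Polynomial.C a).prod) (hc : h.card = n + 1)
    {p : ℝ → ℝ} :
    p ∈ expPoly h ↔ ∃ v : EuclideanSpace ℝ (Fin (n + 1)), companionFun q v = p := by
  have hmon : q.Monic := by
    rw [hq]
    exact Polynomial.monic_multiset_prod_of_monic _ _ fun a _ => Polynomial.monic_X_add_C a
  have hdeg : q.natDegree = n + 1 := by
    rw [hq, Polynomial.natDegree_multiset_prod_of_monic]
    · simp [hc, add_comm]
    · simp only [Multiset.mem_map]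
      rintro _ ⟨a, -, rfl⟩
      exact Polynomial.monic_X_add_C a
  let L : EuclideanSpace ℝ (Fin (n + 1)) →ₗ[ℝ] (ℝ → ℝ) :=
    { toFun := companionFun q
      map_add' := fun v w => funext fun t => inner_add_left _ _ _
      map_smul' := fun c v => funext fun t => inner_smul_left _ _ _ }
  obtain ⟨hfin, hrank⟩ := finite_finrank_expPoly_le h
  have hle : LinearMap.range L ≤ expPoly h := by
    rintro _ ⟨v, rfl⟩
    refine apply_exp_smul_mem_expPoly (companionCLM n q) (innerSL ℝ v) h _ ?_
    rw [← hq]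
    exact aeval_companionCLM hmon hdeg
  have hinj : Function.Injective L := by
    refine (injective_iff_map_eq_zero L).2 fun v hv => ?_
    exact eq_zero_of_companionFun_eq_zero fun t _ => congrFun hv t
  have heq := Submodule.eq_of_le_of_finrank_le hle (by
    rw [LinearMap.finrank_range_of_inj hinj, finrank_euclideanSpace_fin]
    omega)
  rw [← heq]
  rfl

end Companion

/-! ### Continuous dependence on the matrix and attainment of the minimum -/

theorem shiftedSpectrum_spec {d : ℕ} {A : Matrix (Fin d) (Fin d) ℝ} (hA : HasRealSpectrum A)
    (ε : ℝ) :
    (A + ε • 1).charpoly =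
      ((shiftedSpectrum A ε).map fun a => Polynomial.X + Polynomial.C a).prod ∧
    (shiftedSpectrum A ε).card = d := by
  have hs := Matrix.charpoly_splits_of_hasRealSpectrum hA
  constructor
  · have h1 : (A + ε • 1).charpoly = A.charpoly.comp (Polynomial.X - Polynomial.C ε) := by
      have h2 : A + ε • 1 = A - Matrix.scalar (Fin d) (-ε) := by
        rw [map_neg, sub_neg_eq_add, Matrix.smul_one_eq_diagonal, Matrix.scalar_apply]
      rw [h2, Matrix.charpoly_sub_scalar]
      simp [sub_eq_add_neg]
    rw [h1]
    conv_lhs => rw [hs.eq_prod_roots_of_monic A.charpoly_monic]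
    rw [Polynomial.multiset_prod_comp, shiftedSpectrum, sp, Multiset.map_map, Multiset.map_map]
    refine congrArg _ (Multiset.map_congr rfl fun a _ => ?_)
    simp
    ring
  · rw [shiftedSpectrum, Multiset.card_map, sp, ← hs.natDegree_eq_card_roots,
      Matrix.charpoly_natDegree_eq_dim, Fintype.card_fin]

theorem continuous_charpoly_coeff {m : Type*} [Fintype m] [DecidableEq m] (k : ℕ) :
    Continuous fun A : Matrix m m ℝ => A.charpoly.coeff k := by
  have h : ∀ A : Matrix m m ℝ, A.charpoly.coeff k =
      MvPolynomial.eval (fun ij : m × m => A ij.1 ij.2) ((Matrix.charpoly.univ ℝ m).coeff k) := by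
    intro A
    have := Matrix.charpoly.univ_coeff_eval₂Hom m (RingHom.id ℝ) (fun ij : m × m => A ij.1 ij.2) k
    rw [show A = Matrix.of fun i j => A i j from rfl]
    exact this.symm
  simp_rw [h]
  refine (MvPolynomial.continuous_eval _).comp ?_
  fun_prop

theorem continuous_companionCLM (n : ℕ) (ε : ℝ) :
    Continuous fun A : Matrix (Fin (n + 1)) (Fin (n + 1)) ℝ =>
      companionCLM n (A + ε • 1).charpoly := by
  have h1 : Continuous (Matrix.toEuclideanCLM (n := Fin (n + 1)) (𝕜 := ℝ)) :=
    LinearMap.continuous_of_finiteDimensional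
      (Matrix.toEuclideanCLM (n := Fin (n + 1)) (𝕜 := ℝ)).toAlgEquiv.toLinearMap
  refine h1.comp (continuous_matrix fun i j => ?_)
  simp only [companion, Matrix.of_apply]
  split_ifs
  · exact ((continuous_charpoly_coeff _).comp (by fun_prop)).neg
  · exact continuous_const
  · exact continuous_const

theorem nonpos_of_hasDerivAt_of_le {p : ℝ → ℝ} {p' : ℝ} (hp : HasDerivAt p p' 0)
    (hle : ∀ t, 0 ≤ t → p t ≤ p 0) : p' ≤ 0 := by
  have h1 : HasDerivWithinAt p p' (Set.Ioi 0) 0 := hp.hasDerivWithinAt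
  have h2 := (hasDerivWithinAt_iff_tendsto_slope' (by simp)).1 h1
  refine le_of_tendsto h2 ?_
  filter_upwards [self_mem_nhdsWithin] with t ht
  rw [slope_def_field]
  exact div_nonpos_of_nonpos_of_nonneg (by linarith [hle t (le_of_lt ht)])
    (by linarith [Set.mem_Ioi.1 ht])

/-- A function bounded by one on the half-line and with `p'(0) ≥ ε p(0)` satisfies `p(0) < 1`. -/
theorem lt_one_of_abs_le_one {p : ℝ → ℝ} {p' ε : ℝ} (hε : 0 < ε) (hp : HasDerivAt p p' 0)
    (hb : ∀ t, 0 ≤ t → |p t| ≤ 1) (hd : ε * p 0 ≤ p') : p 0 < 1 := by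
  refine lt_of_le_of_ne (le_of_abs_le (hb 0 le_rfl)) fun h => ?_
  have := nonpos_of_hasDerivAt_of_le hp fun t ht => by
    rw [h]
    exact le_of_abs_le (hb t ht)
  rw [h] at hd
  linarith

theorem continuous_exp_clm {V : Type*} [NormedAddCommGroup V] [NormedSpace ℝ V]
    [CompleteSpace V] : Continuous (NormedSpace.exp : (V →L[ℝ] V) → (V →L[ℝ] V)) := by
  let _ : NormedAlgebra ℚ (V →L[ℝ] V) := NormedAlgebra.restrictScalars ℚ ℝ _
  exact NormedSpace.exp_continuous

theorem exp_zero_smul_apply {V : Type*} [NormedAddCommGroup V] [NormedSpace ℝ V]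
    [CompleteSpace V] (M : V →L[ℝ] V) (y : V) : NormedSpace.exp ((0 : ℝ) • M) y = y := by
  rw [zero_smul, NormedSpace.exp_zero, one_apply_eq_self]

section Minimum

variable {n : ℕ}

theorem companionFun_zero (q : Polynomial ℝ) (v : EuclideanSpace ℝ (Fin (n + 1))) :
    companionFun q v 0 = inner ℝ v (EuclideanSpace.single 0 1) := by
  rw [companionFun, exp_zero_smul_apply]

theorem hasDerivAt_companionFun_zero (q : Polynomial ℝ) (v : EuclideanSpace ℝ (Fin (n + 1))) :
    HasDerivAt (companionFun q v)
      (inner ℝ v (companionCLM n q (EuclideanSpace.single 0 1))) 0 := by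
  have := hasDerivAt_inner_exp_smul (companionCLM n q) v (EuclideanSpace.single 0 1) 0
  rw [exp_zero_smul_apply] at this
  exact this

theorem companionFun_smul (q : Polynomial ℝ) (c : ℝ) (v : EuclideanSpace ℝ (Fin (n + 1)))
    (t : ℝ) : companionFun q (c • v) t = c * companionFun q v t :=
  real_inner_smul_left _ _ _

theorem continuous_companionFun (ε t : ℝ) :
    Continuous fun z : Matrix (Fin (n + 1)) (Fin (n + 1)) ℝ × EuclideanSpace ℝ (Fin (n + 1)) =>
      companionFun (z.1 + ε • 1).charpoly z.2 t := by
  have h1 : Continuous fun z : Matrix (Fin (n + 1)) (Fin (n + 1)) ℝ ×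
      EuclideanSpace ℝ (Fin (n + 1)) => companionCLM n (z.1 + ε • 1).charpoly :=
    (continuous_companionCLM n ε).comp continuous_fst
  exact continuous_snd.inner
    ((continuous_exp_clm.comp (h1.const_smul t)).clm_apply continuous_const)

/-- The pairs of a matrix `A ∈ 𝒜` and an exponential polynomial with exponents `-sp(A) - ε` which
is bounded by one on the half-line, in companion coordinates. -/
def boundedPairs (𝒜 : Set (Matrix (Fin (n + 1)) (Fin (n + 1)) ℝ)) (ε : ℝ) :
    Set (Matrix (Fin (n + 1)) (Fin (n + 1)) ℝ × EuclideanSpace ℝ (Fin (n + 1))) :=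
  {z | z.1 ∈ 𝒜 ∧ ∀ t, 0 ≤ t → |companionFun (z.1 + ε • 1).charpoly z.2 t| ≤ 1}

theorem isCompact_boundedPairs {𝒜 : Set (Matrix (Fin (n + 1)) (Fin (n + 1)) ℝ)}
    (hcompact : IsCompact 𝒜) (ε : ℝ) : IsCompact (boundedPairs 𝒜 ε) := by
  have hclosed : IsClosed (boundedPairs 𝒜 ε) := by
    have : boundedPairs 𝒜 ε = (Prod.fst ⁻¹' 𝒜) ∩
        ⋂ (t : ℝ) (_ : 0 ≤ t), {z | |companionFun (z.1 + ε • 1).charpoly z.2 t| ≤ 1} := by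
      ext z
      simp [boundedPairs]
    rw [this]
    exact (hcompact.isClosed.preimage continuous_fst).inter <| isClosed_iInter fun t =>
      isClosed_iInter fun _ => isClosed_le (continuous_companionFun ε t).abs continuous_const
  -- For `‖w‖ = 1` the function of `w` is not identically zero on the half-line. By compactness its
  -- absolute value exceeds `1/(k+1)` somewhere, with one `k` for all `A` and `w`; by scaling, a
  -- function bounded by one has `‖v‖ ≤ k + 1`.
  obtain ⟨k, hk⟩ := (hcompact.prod (isCompact_sphere (0 : EuclideanSpace ℝ (Fin (n + 1))) 1)
    ).elim_directed_cover
      (fun k : ℕ => {z | ∃ t, 0 ≤ t ∧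
        ((k : ℝ) + 1)⁻¹ < |companionFun (z.1 + ε • 1).charpoly z.2 t|})
      (fun k => by
        have : {z : Matrix (Fin (n + 1)) (Fin (n + 1)) ℝ × EuclideanSpace ℝ (Fin (n + 1)) |
            ∃ t, 0 ≤ t ∧ ((k : ℝ) + 1)⁻¹ < |companionFun (z.1 + ε • 1).charpoly z.2 t|} =
            ⋃ (t : ℝ) (_ : 0 ≤ t),
              {z | ((k : ℝ) + 1)⁻¹ < |companionFun (z.1 + ε • 1).charpoly z.2 t|} := by
          ext z
          simp
        rw [this]
        exact isOpen_iUnion fun t => isOpen_iUnion fun _ =>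
          isOpen_lt continuous_const (continuous_companionFun ε t).abs)
      (by
        rintro ⟨A, w⟩ ⟨-, hw⟩
        have hw0 : w ≠ 0 := by
          rintro rfl
          simp at hw
        by_contra hcon
        refine hw0 (eq_zero_of_companionFun_eq_zero (q := (A + ε • 1).charpoly) fun t ht => ?_)
        by_contra h0
        obtain ⟨k, hk⟩ := exists_nat_one_div_lt (abs_pos.2 h0)
        refine hcon (Set.mem_iUnion.2 ⟨k, t, ht, ?_⟩)
        simpa using hk)
      (by
        refine Monotone.directed_le fun k l hkl => ?_
        rintro z ⟨t, ht, hz⟩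
        refine ⟨t, ht, lt_of_le_of_lt ?_ hz⟩
        have : (k : ℝ) ≤ l := by exact_mod_cast hkl
        gcongr)
  refine (hcompact.prod (isCompact_closedBall (0 : EuclideanSpace ℝ (Fin (n + 1)))
    ((k : ℝ) + 1))).of_isClosed_subset hclosed ?_
  rintro ⟨A, v⟩ ⟨hA, hv⟩
  refine ⟨hA, ?_⟩
  rw [mem_closedBall_zero_iff]
  rcases eq_or_ne v 0 with rfl | hv0
  · rw [norm_zero]
    positivity
  have hpos : 0 < ‖v‖ := norm_pos_iff.2 hv0
  obtain ⟨t, ht, hlt⟩ := hk (show (A, ‖v‖⁻¹ • v) ∈ 𝒜 ×ˢ Metric.sphere 0 1 from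
    ⟨hA, by rw [mem_sphere_zero_iff_norm, norm_smul, norm_inv, norm_norm,
      inv_mul_cancel₀ hpos.ne']⟩)
  rw [companionFun_smul, abs_mul, abs_of_pos (inv_pos.2 hpos)] at hlt
  have h1 := hv t ht
  have h2 : ((k : ℝ) + 1)⁻¹ < ‖v‖⁻¹ :=
    hlt.trans_le (mul_le_of_le_one_right (inv_pos.2 hpos).le h1)
  exact ((inv_lt_inv₀ (by positivity) hpos).1 h2).le

theorem kappa_shiftedSpectrum_eq {A : Matrix (Fin (n + 1)) (Fin (n + 1)) ℝ}
    (hA : HasRealSpectrum A) (ε : ℝ) :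
    kappa (shiftedSpectrum A ε) ε = sInf {x | ∃ v : EuclideanSpace ℝ (Fin (n + 1)),
      (∀ t, 0 ≤ t → |companionFun (A + ε • 1).charpoly v t| ≤ 1) ∧
      0 < inner ℝ v (companionCLM n (A + ε • 1).charpoly (EuclideanSpace.single 0 1)) -
        ε * inner ℝ v (EuclideanSpace.single 0 1) ∧
      x = (((1 - inner ℝ v (EuclideanSpace.single 0 1)) /
        (inner ℝ v (companionCLM n (A + ε • 1).charpoly (EuclideanSpace.single 0 1)) -
        ε * inner ℝ v (EuclideanSpace.single 0 1)) : ℝ) : EReal)} := by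
  obtain ⟨h1, h2⟩ := shiftedSpectrum_spec hA ε
  unfold kappa
  congr 1
  ext x
  constructor
  · rintro ⟨p, hp, hb, hd, rfl⟩
    obtain ⟨v, rfl⟩ := (mem_expPoly_iff_companionFun h1 h2).1 hp
    rw [(hasDerivAt_companionFun_zero _ v).deriv, companionFun_zero] at *
    exact ⟨v, hb, sub_pos.2 hd, rfl⟩
  · rintro ⟨v, hb, hd, rfl⟩
    refine ⟨_, (mem_expPoly_iff_companionFun h1 h2).2 ⟨v, rfl⟩, hb, ?_⟩
    rw [(hasDerivAt_companionFun_zero _ v).deriv, companionFun_zero]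
    exact ⟨sub_pos.1 hd, rfl⟩

theorem exists_isLeast_kappa_succ {𝒜 : Set (Matrix (Fin (n + 1)) (Fin (n + 1)) ℝ)}
    (hcompact : IsCompact 𝒜) (hne : 𝒜.Nonempty) (hreal : ∀ A ∈ 𝒜, HasRealSpectrum A)
    {ε : ℝ} (hε : 0 < ε) :
    ∃ m : EReal, IsLeast ((fun A => kappa (shiftedSpectrum A ε) ε) '' 𝒜) m ∧ 0 < m := by
  set e : EuclideanSpace ℝ (Fin (n + 1)) := EuclideanSpace.single 0 1 with he
  set N : Matrix (Fin (n + 1)) (Fin (n + 1)) ℝ × EuclideanSpace ℝ (Fin (n + 1)) → ℝ :=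
    fun z => 1 - inner ℝ z.2 e with hN
  set D : Matrix (Fin (n + 1)) (Fin (n + 1)) ℝ × EuclideanSpace ℝ (Fin (n + 1)) → ℝ :=
    fun z => inner ℝ z.2 (companionCLM n (z.1 + ε • 1).charpoly e) - ε * inner ℝ z.2 e with hD
  have hNc : Continuous N := continuous_const.sub (continuous_snd.inner continuous_const)
  have hDc : Continuous D := by
    refine (continuous_snd.inner ?_).sub
      (continuous_const.mul (continuous_snd.inner continuous_const))
    exact ((continuous_companionCLM n ε).comp continuous_fst).clm_apply continuous_const
  have hNpos : ∀ z ∈ boundedPairs 𝒜 ε, 0 ≤ D z → 0 < N z := by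
    rintro ⟨A, v⟩ ⟨-, hz⟩ hd
    have := lt_one_of_abs_le_one hε (hasDerivAt_companionFun_zero (A + ε • 1).charpoly v) hz
      (by rw [companionFun_zero]; exact sub_nonneg.1 hd)
    rw [companionFun_zero] at this
    exact sub_pos.2 this
  by_cases hadm : ∃ z ∈ boundedPairs 𝒜 ε, 0 < D z
  · obtain ⟨z₀, hz₀, hD₀⟩ := hadm
    -- The value at one admissible pair. The condition `N ≤ c₀ D` discards only pairs with larger
    -- quotient, and excludes `D = 0`, where `N > 0`; so the quotient is continuous on the compact
    -- set `S`.
    set c₀ := N z₀ / D z₀ with hc₀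
    set S := boundedPairs 𝒜 ε ∩ ({z | 0 ≤ D z} ∩ {z | N z ≤ c₀ * D z}) with hS
    have hSc : IsCompact S := (isCompact_boundedPairs hcompact ε).inter_right
      ((isClosed_le continuous_const hDc).inter (isClosed_le hNc (continuous_const.mul hDc)))
    have hSpos : ∀ z ∈ S, 0 < D z := by
      rintro z ⟨hz, hz1, hz2⟩
      refine lt_of_le_of_ne hz1 fun h => ?_
      have h1 := hNpos z hz hz1
      have h2 : N z ≤ c₀ * D z := hz2
      rw [← h, mul_zero] at h2
      linarith
    have hz₀S : z₀ ∈ S := ⟨hz₀, hD₀.le, by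
      change N z₀ ≤ c₀ * D z₀
      rw [hc₀, div_mul_cancel₀ _ hD₀.ne']⟩
    obtain ⟨z₁, hz₁, hmin⟩ := hSc.exists_isMinOn ⟨z₀, hz₀S⟩
      (f := fun z => N z / D z) (hNc.continuousOn.div hDc.continuousOn fun z hz => (hSpos z hz).ne')
    have hall : ∀ z ∈ boundedPairs 𝒜 ε, 0 < D z → N z₁ / D z₁ ≤ N z / D z := by
      intro z hz hDz
      by_cases hzc : N z ≤ c₀ * D z
      · exact hmin ⟨hz, hDz.le, hzc⟩
      · have h1 : N z₁ / D z₁ ≤ c₀ := hmin hz₀S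
        exact h1.trans ((le_div_iff₀ hDz).2 (not_le.1 hzc).le)
    have hlb : ∀ A ∈ 𝒜, ((N z₁ / D z₁ : ℝ) : EReal) ≤ kappa (shiftedSpectrum A ε) ε := by
      intro A hA
      rw [kappa_shiftedSpectrum_eq (hreal A hA)]
      refine le_sInf ?_
      rintro _ ⟨v, hb, hd, rfl⟩
      exact EReal.coe_le_coe_iff.2 (hall (A, v) ⟨hA, hb⟩ hd)
    refine ⟨((N z₁ / D z₁ : ℝ) : EReal), ⟨⟨z₁.1, hz₁.1.1, le_antisymm ?_ (hlb _ hz₁.1.1)⟩, ?_⟩, ?_⟩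
    · change kappa (shiftedSpectrum z₁.1 ε) ε ≤ _
      rw [kappa_shiftedSpectrum_eq (hreal _ hz₁.1.1)]
      exact sInf_le ⟨z₁.2, hz₁.1.2, hSpos _ hz₁, rfl⟩
    · rintro _ ⟨A, hA, rfl⟩
      exact hlb A hA
    · exact_mod_cast div_pos (hNpos _ hz₁.1 (hSpos _ hz₁).le) (hSpos _ hz₁)
  · have htop : ∀ A ∈ 𝒜, kappa (shiftedSpectrum A ε) ε = ⊤ := by
      intro A hA
      rw [kappa_shiftedSpectrum_eq (hreal A hA), sInf_eq_top]
      rintro _ ⟨v, hb, hd, rfl⟩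
      exact absurd ⟨(A, v), ⟨hA, hb⟩, hd⟩ hadm
    obtain ⟨A, hA⟩ := hne
    refine ⟨⊤, ⟨⟨A, hA, htop A hA⟩, ?_⟩, EReal.zero_lt_top⟩
    rintro _ ⟨B, hB, rfl⟩
    exact (htop B hB).ge

end Minimum

theorem exists_isLeast_kappa {d : ℕ} {𝒜 : Set (Matrix (Fin d) (Fin d) ℝ)}
    (hcompact : IsCompact 𝒜) (hne : 𝒜.Nonempty) (hreal : ∀ A ∈ 𝒜, HasRealSpectrum A)
    {ε : ℝ} (hε : 0 < ε) :
    ∃ m : EReal, IsLeast ((fun A => kappa (shiftedSpectrum A ε) ε) '' 𝒜) m ∧ 0 < m := by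
  cases d with
  | succ n => exact exists_isLeast_kappa_succ hcompact hne hreal hε
  | zero =>
    -- In dimension zero `𝒫_h` contains only the zero function, so there are no competitors.
    have htop : ∀ A ∈ 𝒜, kappa (shiftedSpectrum A ε) ε = ⊤ := by
      intro A hA
      have hs : shiftedSpectrum A ε = 0 :=
        Multiset.card_eq_zero.1 (shiftedSpectrum_spec (hreal A hA) ε).2
      rw [hs, kappa, sInf_eq_top]
      rintro _ ⟨p, hp, -, hd, -⟩
      have : p = 0 := by
        simpa [expPoly] using hp
      simp [this] at hd
    obtain ⟨A, hA⟩ := hne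
    refine ⟨⊤, ⟨⟨A, hA, htop A hA⟩, ?_⟩, EReal.zero_lt_top⟩
    rintro _ ⟨B, hB, rfl⟩
    exact (htop B hB).ge

/-! ### Concatenation of flows into trajectories -/

variable {d : ℕ}

/-- A continuous curve which, at every `t ≥ 0`, has the right derivative `A t (x t)`, for a
measurable switching law `A`. -/
structure IsPath (𝒜 : Set (Matrix (Fin d) (Fin d) ℝ)) (A : ℝ → Matrix (Fin d) (Fin d) ℝ)
    (x : ℝ → EuclideanSpace ℝ (Fin d)) : Prop where
  measurable : ∀ i j, Measurable fun t => A t i j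
  mem : ∀ t, A t ∈ 𝒜
  continuous : Continuous x
  hasDerivWithinAt : ∀ t, 0 ≤ t →
    HasDerivWithinAt x (Matrix.toEuclideanCLM (𝕜 := ℝ) (A t) (x t)) (Set.Ici t) t

theorem continuous_toEuclideanCLM :
    Continuous (Matrix.toEuclideanCLM (n := Fin d) (𝕜 := ℝ)) :=
  LinearMap.continuous_of_finiteDimensional
    (Matrix.toEuclideanCLM (n := Fin d) (𝕜 := ℝ)).toAlgEquiv.toLinearMap

theorem hasDerivAt_exp_sub_smul_apply {V : Type*} [NormedAddCommGroup V] [NormedSpace ℝ V]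
    [CompleteSpace V] (M : V →L[ℝ] V) (y : V) (T t : ℝ) :
    HasDerivAt (fun t : ℝ => NormedSpace.exp ((t - T) • M) y)
      (M (NormedSpace.exp ((t - T) • M) y)) t := by
  have := (hasDerivAt_exp_smul_apply' M y (t - T)).scomp t ((hasDerivAt_id t).sub_const T)
  rw [one_smul] at this
  exact this

theorem isPath_exp {𝒜 : Set (Matrix (Fin d) (Fin d) ℝ)} {B : Matrix (Fin d) (Fin d) ℝ}
    (hB : B ∈ 𝒜) (y : EuclideanSpace ℝ (Fin d)) :
    IsPath 𝒜 (fun _ => B)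
      (fun t => NormedSpace.exp (t • Matrix.toEuclideanCLM (𝕜 := ℝ) B) y) where
  measurable _ _ := measurable_const
  mem _ := hB
  continuous := continuous_iff_continuousAt.2 fun t =>
    (hasDerivAt_exp_smul_apply' _ y t).continuousAt
  hasDerivWithinAt t _ := (hasDerivAt_exp_smul_apply' _ y t).hasDerivWithinAt

/-- Switching to the constant law `B` at time `T`. -/
theorem IsPath.switch {𝒜 : Set (Matrix (Fin d) (Fin d) ℝ)} {A : ℝ → Matrix (Fin d) (Fin d) ℝ}
    {x : ℝ → EuclideanSpace ℝ (Fin d)} (hx : IsPath 𝒜 A x) {B : Matrix (Fin d) (Fin d) ℝ}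
    (hB : B ∈ 𝒜) (T : ℝ) :
    IsPath 𝒜 (fun t => if t < T then A t else B)
      (fun t => if t ≤ T then x t else
        NormedSpace.exp ((t - T) • Matrix.toEuclideanCLM (𝕜 := ℝ) B) (x T)) where
  measurable i j := by
    have : (fun t => (if t < T then A t else B) i j) = fun t => if t < T then A t i j else B i j := by
      ext t
      split_ifs <;> rfl
    rw [this]
    exact Measurable.ite measurableSet_Iio (hx.measurable i j) measurable_const
  mem t := by
    split_ifs
    exacts [hx.mem t, hB]
  continuous := by
    refine Continuous.if_le hx.continuous (continuous_iff_continuousAt.2 fun t =>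
      (hasDerivAt_exp_sub_smul_apply _ (x T) T t).continuousAt) continuous_id continuous_const ?_
    rintro t rfl
    rw [sub_self, exp_zero_smul_apply]
  hasDerivWithinAt t ht := by
    rcases lt_or_ge t T with h | h
    · simp only [h, h.le, if_true]
      refine (hx.hasDerivWithinAt t ht).congr_of_eventuallyEq ?_ (by simp [h.le])
      filter_upwards [nhdsWithin_le_nhds (gt_mem_nhds h)] with s hs
      simp [le_of_lt hs]
    · have heq : ∀ s, T ≤ s → (if s ≤ T then x s else
          NormedSpace.exp ((s - T) • Matrix.toEuclideanCLM (𝕜 := ℝ) B) (x T)) =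
          NormedSpace.exp ((s - T) • Matrix.toEuclideanCLM (𝕜 := ℝ) B) (x T) := by
        intro s hs
        split_ifs with h1
        · rw [le_antisymm h1 hs, sub_self, exp_zero_smul_apply]
        · rfl
      rw [heq t h, if_neg h.not_gt]
      refine (hasDerivAt_exp_sub_smul_apply _ (x T) T t).hasDerivWithinAt.congr_of_eventuallyEq ?_
        (heq t h)
      filter_upwards [self_mem_nhdsWithin] with s hs using heq s (h.trans hs)

/-- A right derivative bounded on compact intervals makes the path Lipschitz there, hence absolutely
continuous and differentiable almost everywhere; where the derivative exists it equals the right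
derivative. -/
theorem IsPath.isTrajectory {𝒜 : Set (Matrix (Fin d) (Fin d) ℝ)} (hcompact : IsCompact 𝒜)
    {A : ℝ → Matrix (Fin d) (Fin d) ℝ} {x : ℝ → EuclideanSpace ℝ (Fin d)} (hx : IsPath 𝒜 A x) :
    IsTrajectory 𝒜 x := by
  obtain ⟨M, hM⟩ := hcompact.exists_bound_of_continuousOn
    (continuous_toEuclideanCLM (d := d)).continuousOn
  have hlip : ∀ T, ∃ K, LipschitzOnWith K x (Set.Icc 0 T) := by
    intro T
    obtain ⟨R, hR⟩ := (isCompact_Icc (a := (0 : ℝ)) (b := T)).exists_bound_of_continuousOn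
      hx.continuous.continuousOn
    have hle : ∀ a b, 0 ≤ a → a ≤ b → b ≤ T → ‖x b - x a‖ ≤ |M| * |R| * (b - a) := by
      intro a b ha hab hb
      refine norm_image_sub_le_of_norm_deriv_right_le_segment hx.continuous.continuousOn
        (fun t ht => hx.hasDerivWithinAt t (ha.trans ht.1)) (fun t ht => ?_) b ⟨hab, le_rfl⟩
      refine (ContinuousLinearMap.le_opNorm _ _).trans ?_
      gcongr
      · exact (hM _ (hx.mem t)).trans (le_abs_self M)
      · exact (hR t ⟨ha.trans ht.1, ht.2.le.trans hb⟩).trans (le_abs_self R)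
    refine ⟨(|M| * |R|).toNNReal, LipschitzOnWith.of_dist_le_mul fun a ha b hb => ?_⟩
    rw [Real.coe_toNNReal _ (by positivity)]
    rcases le_total a b with h | h
    · rw [dist_comm, dist_eq_norm, dist_comm, Real.dist_eq, abs_of_nonneg (sub_nonneg.2 h)]
      exact hle a b ha.1 h hb.2
    · rw [dist_eq_norm, Real.dist_eq, abs_of_nonneg (sub_nonneg.2 h)]
      exact hle b a hb.1 h ha.2
  refine ⟨A, hx.measurable, fun t _ => hx.mem t, fun T hT => ?_, ?_⟩
  · obtain ⟨K, hK⟩ := hlip T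
    exact LipschitzOnWith.absolutelyContinuousOnInterval (K := K) (by rwa [Set.uIcc_of_le hT])
  · have hae : ∀ n : ℕ, ∀ᵐ t : ℝ, t ∈ Set.Icc (0 : ℝ) n →
        DifferentiableWithinAt ℝ x (Set.Icc (0 : ℝ) n) t := fun n =>
      (hlip n).choose_spec.ae_differentiableWithinAt_of_mem_real
    have h0 : ∀ᵐ t : ℝ, t ≠ 0 := by
      simp [ae_iff]
    filter_upwards [ae_all_iff.2 hae, h0] with t h1 h2 ht
    obtain ⟨n, hn⟩ := exists_nat_gt t
    have ht' : 0 < t := lt_of_le_of_ne ht h2.symm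
    have hd : DifferentiableAt ℝ x t :=
      (h1 n ⟨ht, hn.le⟩).differentiableAt (Icc_mem_nhds ht' hn)
    have := (uniqueDiffWithinAt_Ici t).eq_deriv _ hd.hasDerivAt.hasDerivWithinAt
      (hx.hasDerivWithinAt t ht)
    rw [← this]
    exact hd.hasDerivAt

/-! ### Boundedness of the shifted flow semigroup -/

/-- The semigroup generated by the flows of the shifted family `𝒜 + ε`. -/
noncomputable def flowSemigroup (𝒜 : Set (Matrix (Fin d) (Fin d) ℝ)) (ε : ℝ) :
    Submonoid (EuclideanSpace ℝ (Fin d) →L[ℝ] EuclideanSpace ℝ (Fin d)) :=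
  Submonoid.closure {s | ∃ B ∈ 𝒜, ∃ t : ℝ, 0 ≤ t ∧
    s = NormedSpace.exp (t • (Matrix.toEuclideanCLM (𝕜 := ℝ) B + ε • 1))}

theorem exp_smul_add_smul_one {V : Type*} [NormedAddCommGroup V] [NormedSpace ℝ V]
    [CompleteSpace V] (M : V →L[ℝ] V) (t ε : ℝ) :
    NormedSpace.exp (t • (M + ε • 1)) = Real.exp (ε * t) • NormedSpace.exp (t • M) := by
  let _ : NormedAlgebra ℚ (V →L[ℝ] V) := NormedAlgebra.restrictScalars ℚ ℝ _
  have h1 : t • (ε • (1 : V →L[ℝ] V)) = algebraMap ℝ (V →L[ℝ] V) (ε * t) := by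
    rw [Algebra.algebraMap_eq_smul_one, smul_smul, mul_comm]
  rw [smul_add, h1, NormedSpace.exp_add_of_commute (Algebra.commutes _ _).symm,
    ← NormedSpace.algebraMap_exp_comm, ← Real.exp_eq_exp_ℝ, ← Algebra.commutes, ← Algebra.smul_def]

theorem exp_smul_switch_apply (B : Matrix (Fin d) (Fin d) ℝ) (x : ℝ → EuclideanSpace ℝ (Fin d))
    (ε T : ℝ) {t : ℝ} (ht : 0 ≤ t) :
    Real.exp (ε * (T + t)) • (if T + t ≤ T then x (T + t) else
        NormedSpace.exp ((T + t - T) • Matrix.toEuclideanCLM (𝕜 := ℝ) B) (x T)) =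
      NormedSpace.exp (t • (Matrix.toEuclideanCLM (𝕜 := ℝ) B + ε • 1))
        (Real.exp (ε * T) • x T) := by
  have h1 : (if T + t ≤ T then x (T + t) else
      NormedSpace.exp ((T + t - T) • Matrix.toEuclideanCLM (𝕜 := ℝ) B) (x T)) =
      NormedSpace.exp (t • Matrix.toEuclideanCLM (𝕜 := ℝ) B) (x T) := by
    rw [add_sub_cancel_left]
    split_ifs with h
    · obtain rfl : t = 0 := by linarith
      rw [exp_zero_smul_apply, add_zero]
    · rfl
  rw [h1, exp_smul_add_smul_one, map_smul, smul_apply, smul_smul, ← Real.exp_add]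
  ring_nf

/-- An element of the semigroup is a word in flows, realized by switching through its factors from
right to left. The weight `e^{εT}` turns the flow of `B` into that of `B + ε`. -/
theorem IsPath.exists_extend {𝒜 : Set (Matrix (Fin d) (Fin d) ℝ)} {ε : ℝ}
    {s : EuclideanSpace ℝ (Fin d) →L[ℝ] EuclideanSpace ℝ (Fin d)} (hs : s ∈ flowSemigroup 𝒜 ε)
    {A : ℝ → Matrix (Fin d) (Fin d) ℝ} {x : ℝ → EuclideanSpace ℝ (Fin d)} (hx : IsPath 𝒜 A x)
    (T : ℝ) :
    ∃ A' x' T', IsPath 𝒜 A' x' ∧ T ≤ T' ∧ Set.EqOn A' A (Set.Iio T) ∧ Set.EqOn x' x (Set.Iic T) ∧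
      Real.exp (ε * T') • x' T' = s (Real.exp (ε * T) • x T) := by
  induction hs using Submonoid.closure_induction generalizing A x T with
  | one => exact ⟨A, x, T, hx, le_rfl, fun _ _ => rfl, fun _ _ => rfl, rfl⟩
  | mul s₁ s₂ _ _ h₁ h₂ =>
    obtain ⟨A₂, x₂, T₂, hp₂, hT₂, hA₂, hx₂, he₂⟩ := h₂ hx T
    obtain ⟨A₁, x₁, T₁, hp₁, hT₁, hA₁, hx₁, he₁⟩ := h₁ hp₂ T₂
    refine ⟨A₁, x₁, T₁, hp₁, hT₂.trans hT₁,
      (hA₁.mono (Set.Iio_subset_Iio hT₂)).trans hA₂,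
      (hx₁.mono (Set.Iic_subset_Iic.2 hT₂)).trans hx₂, ?_⟩
    rw [he₁, he₂, mul_apply_eq_comp]
  | mem s hs =>
    obtain ⟨B, hB, t, ht, rfl⟩ := hs
    refine ⟨_, _, T + t, hx.switch hB T, by linarith, fun r hr => if_pos hr,
      fun r hr => if_pos hr, exp_smul_switch_apply B x ε T ht⟩

/-- Gluing of paths which extend each other up to times tending to infinity. -/
theorem exists_isPath_eqOn {𝒜 : Set (Matrix (Fin d) (Fin d) ℝ)}
    {A : ℕ → ℝ → Matrix (Fin d) (Fin d) ℝ} {x : ℕ → ℝ → EuclideanSpace ℝ (Fin d)} {T : ℕ → ℝ}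
    (hp : ∀ k, IsPath 𝒜 (A k) (x k)) (hT : ∀ k, T k + 1 ≤ T (k + 1))
    (hA : ∀ k, Set.EqOn (A (k + 1)) (A k) (Set.Iio (T k)))
    (hx : ∀ k, Set.EqOn (x (k + 1)) (x k) (Set.Iic (T k))) :
    ∃ A' x', IsPath 𝒜 A' x' ∧ ∀ k, x' (T k) = x k (T k) := by
  have hmono : StrictMono T := strictMono_nat_of_lt_succ fun k => by linarith [hT k]
  have hlarge : ∀ t, ∃ k, t < T k := by
    have h1 : ∀ k : ℕ, T 0 + k ≤ T k := fun k => by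
      induction k with
      | zero => simp
      | succ k ih =>
        push_cast
        linarith [hT k]
    intro t
    obtain ⟨k, hk⟩ := exists_nat_gt (t - T 0)
    exact ⟨k, by linarith [h1 k]⟩
  choose N hN using hlarge
  have hA' : ∀ k m, k ≤ m → Set.EqOn (A m) (A k) (Set.Iio (T k)) := fun k m hkm => by
    induction m, hkm using Nat.le_induction with
    | base => exact fun _ _ => rfl
    | succ m hkm ih =>
      exact ((hA m).mono (Set.Iio_subset_Iio (hmono.monotone hkm))).trans ih
  have hx' : ∀ k m, k ≤ m → Set.EqOn (x m) (x k) (Set.Iic (T k)) := fun k m hkm => by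
    induction m, hkm using Nat.le_induction with
    | base => exact fun _ _ => rfl
    | succ m hkm ih =>
      exact ((hx m).mono (Set.Iic_subset_Iic.2 (hmono.monotone hkm))).trans ih
  have hAN : ∀ k t, t < T k → A (N t) t = A k t := fun k t ht => by
    rcases le_total k (N t) with h | h
    · exact hA' k _ h ht
    · exact (hA' _ _ h (hN t)).symm
  have hxN : ∀ k t, t < T k → x (N t) t = x k t := fun k t ht => by
    rcases le_total k (N t) with h | h
    · exact hx' k _ h ht.le
    · exact (hx' _ _ h (hN t).le).symm
  have hev : ∀ t, (fun t => x (N t) t) =ᶠ[nhds t] x (N t) := fun t => by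
    filter_upwards [gt_mem_nhds (hN t)] with s hs using hxN _ s hs
  refine ⟨fun t => A (N t) t, fun t => x (N t) t, ⟨fun i j => ?_, fun t => (hp _).mem t, ?_, ?_⟩,
    fun k => ?_⟩
  -- At each time the laws `A k` are eventually constant in `k`, so the glued law is a pointwise
  -- limit of measurable ones.
  · refine measurable_of_tendsto_metrizable (fun k => (hp k).measurable i j)
      (tendsto_pi_nhds.2 fun t => tendsto_const_nhds.congr' ?_)
    filter_upwards [eventually_ge_atTop (N t)] with k hk
    rw [hA' _ _ hk (hN t)]
  · exact continuous_iff_continuousAt.2 fun t =>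
      (hp (N t)).continuous.continuousAt.congr (hev t).symm
  · intro t ht
    exact ((hp (N t)).hasDerivWithinAt t ht).congr_of_eventuallyEq
      (nhdsWithin_le_nhds (hev t)) rfl
  · change x (N (T k)) (T k) = x k (T k)
    rw [hxN (k + 1) (T k) (hmono (Nat.lt_succ_self k))]
    exact hx k (Set.mem_Iic.2 le_rfl)

theorem isUnit_of_mem_flowSemigroup {𝒜 : Set (Matrix (Fin d) (Fin d) ℝ)} {ε : ℝ}
    {s : EuclideanSpace ℝ (Fin d) →L[ℝ] EuclideanSpace ℝ (Fin d)} (hs : s ∈ flowSemigroup 𝒜 ε) :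
    IsUnit s := by
  induction hs using Submonoid.closure_induction with
  | one => exact isUnit_one
  | mul _ _ _ _ h₁ h₂ => exact h₁.mul h₂
  | mem s hs =>
    obtain ⟨B, -, t, -, rfl⟩ := hs
    let _ : NormedAlgebra ℚ (EuclideanSpace ℝ (Fin d) →L[ℝ] EuclideanSpace ℝ (Fin d)) :=
      NormedAlgebra.restrictScalars ℚ ℝ _
    exact NormedSpace.isUnit_exp _

/-- The vectors whose orbit under a semigroup of operators is bounded. -/
def boundedOrbit {V : Type*} [NormedAddCommGroup V] [NormedSpace ℝ V]
    (S : Submonoid (V →L[ℝ] V)) : Submodule ℝ V where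
  carrier := {x | ∃ C, ∀ s ∈ S, ‖s x‖ ≤ C}
  zero_mem' := ⟨0, fun s _ => by simp⟩
  add_mem' := by
    rintro x y ⟨C, hC⟩ ⟨C', hC'⟩
    refine ⟨C + C', fun s hs => ?_⟩
    rw [map_add]
    exact norm_add_le_of_le (hC s hs) (hC' s hs)
  smul_mem' := by
    rintro c x ⟨C, hC⟩
    refine ⟨‖c‖ * C, fun s hs => ?_⟩
    rw [map_smul, norm_smul]
    exact mul_le_mul_of_nonneg_left (hC s hs) (norm_nonneg c)

/-- Every `s ∈ S` maps the subspace of bounded orbits into itself; if `s` is injective, finite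
dimension makes this map onto, so no outside vector enters the subspace. Hence an unbounded orbit
stays unbounded after any flow. -/
theorem mem_boundedOrbit_of_apply_mem {V : Type*} [NormedAddCommGroup V] [NormedSpace ℝ V]
    [FiniteDimensional ℝ V] {S : Submonoid (V →L[ℝ] V)} {s : V →L[ℝ] V} (hs : s ∈ S)
    (hu : IsUnit s) {x : V} (hx : s x ∈ boundedOrbit S) : x ∈ boundedOrbit S := by
  have hinj : Function.Injective s := by
    obtain ⟨u, rfl⟩ := hu
    refine Function.LeftInverse.injective (g := (↑u⁻¹ : V →L[ℝ] V)) fun y => ?_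
    rw [← mul_apply_eq_comp, Units.inv_mul, one_apply_eq_self]
  have hle : (boundedOrbit S).map (s : V →ₗ[ℝ] V) ≤ boundedOrbit S := by
    rintro _ ⟨y, ⟨C, hC⟩, rfl⟩
    exact ⟨C, fun r hr => hC (r * s) (mul_mem hr hs)⟩
  have heq := Submodule.eq_of_le_of_finrank_le hle
    (LinearEquiv.finrank_eq (Submodule.equivMapOfInjective (s : V →ₗ[ℝ] V) hinj _)).le
  rw [← heq] at hx
  obtain ⟨y, hy, hyx⟩ := hx
  rwa [← hinj hyx]

/-- If `σ(𝒜) < -ε`, then the semigroup generated by the flows of `𝒜 + ε` is bounded. -/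
theorem exists_norm_le_of_mem_flowSemigroup {𝒜 : Set (Matrix (Fin d) (Fin d) ℝ)}
    (hcompact : IsCompact 𝒜) (hne : 𝒜.Nonempty) {ε : ℝ}
    (hσ : lyapunovExponent 𝒜 < ((-ε : ℝ) : EReal)) :
    ∃ C, ∀ s ∈ flowSemigroup 𝒜 ε, ‖s‖ ≤ C := by
  set S := flowSemigroup 𝒜 ε with hS
  suffices htop : ∀ x, x ∈ boundedOrbit S by
    obtain ⟨C, hC⟩ := banach_steinhaus (g := fun s : S => s.1)
      fun x => by
        obtain ⟨C, hC⟩ := htop x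
        exact ⟨C, fun s => hC s.1 s.2⟩
    exact ⟨C, fun s hs => hC ⟨s, hs⟩⟩
  by_contra! hcon
  obtain ⟨x₀, hx₀⟩ := hcon
  obtain ⟨B₀, hB₀⟩ := hne
  obtain ⟨_, ⟨α, hα, rfl⟩, hαε⟩ := sInf_lt_iff.1 hσ
  have hαε : α < -ε := EReal.coe_lt_coe_iff.1 hαε
  let Good : (ℝ → Matrix (Fin d) (Fin d) ℝ) × (ℝ → EuclideanSpace ℝ (Fin d)) × ℝ → Prop :=
    fun z => IsPath 𝒜 z.1 z.2.1 ∧ 0 ≤ z.2.2 ∧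
      Real.exp (ε * z.2.2) • z.2.1 z.2.2 ∉ boundedOrbit S
  -- Flowing along `B₀` for unit time makes the switching times tend to infinity; then a semigroup
  -- element pushes the weighted norm above `k`. Both operators are invertible, so the orbit remains
  -- unbounded and the construction can be iterated.
  have hstep : ∀ (k : ℕ) (z : {z // Good z}), ∃ z' : {z // Good z},
      z.1.2.2 + 1 ≤ z'.1.2.2 ∧ Set.EqOn z'.1.1 z.1.1 (Set.Iio z.1.2.2) ∧
      Set.EqOn z'.1.2.1 z.1.2.1 (Set.Iic z.1.2.2) ∧
      (k : ℝ) < ‖Real.exp (ε * z'.1.2.2) • z'.1.2.1 z'.1.2.2‖ := by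
    rintro k ⟨⟨A, x, T⟩, hp, hT, hb⟩
    have hone : NormedSpace.exp ((1 : ℝ) • (Matrix.toEuclideanCLM (𝕜 := ℝ) B₀ + ε • 1)) ∈ S :=
      Submonoid.subset_closure ⟨B₀, hB₀, 1, zero_le_one, rfl⟩
    have hb₁ : Real.exp (ε * (T + 1)) • (if T + 1 ≤ T then x (T + 1) else
        NormedSpace.exp ((T + 1 - T) • Matrix.toEuclideanCLM (𝕜 := ℝ) B₀) (x T)) ∉
        boundedOrbit S := by
      rw [exp_smul_switch_apply B₀ x ε T zero_le_one]
      exact fun h => hb (mem_boundedOrbit_of_apply_mem hone (isUnit_of_mem_flowSemigroup hone) h)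
    obtain ⟨s, hs, hks⟩ : ∃ s ∈ S, (k : ℝ) < ‖s (Real.exp (ε * (T + 1)) • (if T + 1 ≤ T then
        x (T + 1) else NormedSpace.exp ((T + 1 - T) • Matrix.toEuclideanCLM (𝕜 := ℝ) B₀)
          (x T)))‖ := by
      by_contra! h
      exact hb₁ ⟨k, h⟩
    obtain ⟨A', x', T', hp', hT', hA', hx', he⟩ := (hp.switch hB₀ T).exists_extend hs (T + 1)
    refine ⟨⟨(A', x', T'), hp', by dsimp only at hT ⊢; linarith, ?_⟩, hT', ?_, ?_, ?_⟩
    · dsimp only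
      rw [he]
      exact fun h => hb₁ (mem_boundedOrbit_of_apply_mem hs (isUnit_of_mem_flowSemigroup hs) h)
    · exact (hA'.mono (Set.Iio_subset_Iio (by simp))).trans fun r hr => if_pos hr
    · exact (hx'.mono (Set.Iic_subset_Iic.2 (by simp))).trans fun r hr => if_pos hr
    · dsimp only
      rw [he]
      exact hks
  choose F hF using hstep
  let z : ℕ → {z // Good z} := fun k => Nat.rec
    ⟨(_, _, 0), isPath_exp hB₀ x₀, le_rfl, by simpa [exp_zero_smul_apply] using hx₀⟩ 
      (fun k z => F k z) k
  obtain ⟨A', x', hp, hx'⟩ := exists_isPath_eqOn (fun k => (z k).2.1) (fun k => (hF k (z k)).1)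
    (fun k => (hF k (z k)).2.1) (fun k => (hF k (z k)).2.2.1)
  obtain ⟨C, hC⟩ := hα x' (hp.isTrajectory hcompact)
  obtain ⟨k, hk⟩ := exists_nat_gt C
  have h1 : (k : ℝ) < ‖Real.exp (ε * (z (k + 1)).1.2.2) • x' (z (k + 1)).1.2.2‖ := by
    rw [hx' (k + 1)]
    exact (hF k (z k)).2.2.2
  have hT0 : 0 ≤ (z (k + 1)).1.2.2 := (z (k + 1)).2.2.1
  generalize (z (k + 1)).1.2.2 = T at h1 hT0
  have h2 := hC T hT0
  have hC0 : 0 ≤ C := by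
    have := hC 0 le_rfl
    rw [mul_zero, Real.exp_zero, mul_one] at this
    exact (norm_nonneg _).trans this
  have h3 : ‖Real.exp (ε * T) • x' T‖ ≤ C := by
    rw [norm_smul, Real.norm_eq_abs, Real.abs_exp]
    calc Real.exp (ε * T) * ‖x' T‖ ≤ Real.exp (ε * T) * (C * Real.exp (α * T)) := by gcongr
      _ = C * Real.exp ((ε + α) * T) := by
        rw [add_mul, Real.exp_add]
        ring
      _ ≤ C * 1 := by
        gcongr
        exact Real.exp_le_one_iff.2 (mul_nonpos_of_nonpos_of_nonneg (by linarith) hT0)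
      _ = C := mul_one C
  linarith

/-! ### Contraction of the Euler step and the joint spectral radius -/

/-- Geometric bounds with a ratio below one for all products bound the joint spectral radius. -/
theorem jointSpectralRadius_lt_one {ℳ : Set (Matrix (Fin d) (Fin d) ℝ)} {K q : ℝ} (hq0 : 0 ≤ q)
    (hq1 : q < 1)
    (h : ∀ l : List (Matrix (Fin d) (Fin d) ℝ), (∀ B ∈ l, B ∈ ℳ) →
      ‖Matrix.toEuclideanCLM (𝕜 := ℝ) l.prod‖ ≤ K * q ^ l.length) :
    jointSpectralRadius ℳ < 1 := by
  -- The slack between `q` and `r` absorbs the constant: `K q^k ≤ r^k` for large `k`.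
  obtain ⟨r, hqr, hr1⟩ := exists_between hq1
  have hr0 : 0 < r := hq0.trans_lt hqr
  have hlim : Tendsto (fun k : ℕ => K * (q / r) ^ k) atTop (nhds (K * 0)) :=
    (tendsto_pow_atTop_nhds_zero_of_lt_one (by positivity) ((div_lt_one hr0).2 hqr)).const_mul K
  rw [mul_zero] at hlim
  refine lt_of_le_of_lt (limsup_le_of_le (a := ENNReal.ofReal r) (by isBoundedDefault) ?_)
    (ENNReal.ofReal_lt_one.2 hr1)
  filter_upwards [hlim.eventually (ge_mem_nhds one_pos), eventually_ge_atTop 1] with k hk hk1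
  refine iSup₂_le fun A hA => ?_
  have hk' : K * q ^ k ≤ r ^ k := by
    rw [div_pow, ← mul_div_assoc, div_le_one (by positivity)] at hk
    exact hk
  have h1 : ‖Matrix.toEuclideanCLM (𝕜 := ℝ) (List.ofFn A).prod‖ ≤ r ^ k := by
    refine (h _ ?_).trans (by rwa [List.length_ofFn])
    simpa [List.mem_ofFn] using hA
  calc ‖Matrix.toEuclideanCLM (𝕜 := ℝ) (List.ofFn A).prod‖ₑ ^ (1 / (k : ℝ))
      ≤ ENNReal.ofReal (r ^ k) ^ (1 / (k : ℝ)) := by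
        rw [← ofReal_norm]
        gcongr
    _ = ENNReal.ofReal r := by
        rw [ENNReal.ofReal_rpow_of_nonneg (by positivity) (by positivity), one_div,
          Real.pow_rpow_inv_natCast hr0.le (by omega)]

theorem norm_le_of_forall_inner_le {V : Type*} [NormedAddCommGroup V] [InnerProductSpace ℝ V]
    {y : V} {c : ℝ} (hc : 0 ≤ c) (h : ∀ u : V, ‖u‖ ≤ 1 → inner ℝ u y ≤ c) : ‖y‖ ≤ c := by
  rcases eq_or_ne y 0 with rfl | hy
  · simpa using hc
  have hpos : 0 < ‖y‖ := norm_pos_iff.2 hy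
  have := h (‖y‖⁻¹ • y) (by rw [norm_smul, norm_inv, norm_norm, inv_mul_cancel₀ hpos.ne'])
  rwa [real_inner_smul_left, real_inner_self_eq_norm_sq, sq, inv_mul_cancel_left₀ hpos.ne'] at this

theorem aeval_toEuclideanCLM_charpoly (B : Matrix (Fin d) (Fin d) ℝ) :
    Polynomial.aeval (Matrix.toEuclideanCLM (𝕜 := ℝ) B) B.charpoly = 0 := by
  have := Polynomial.aeval_algHom_apply
    (Matrix.toEuclideanCLM (n := Fin d) (𝕜 := ℝ)).toAlgEquiv.toAlgHom B B.charpoly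
  rw [Matrix.aeval_self_charpoly, map_zero] at this
  exact this

/-- One Euler step of length `τ < κ` shrinks every linear functional which is bounded by one along
the flow of `A + ε`. -/
theorem inner_euler_lt_one {A : Matrix (Fin d) (Fin d) ℝ} (hA : HasRealSpectrum A) {ε τ : ℝ}
    (hε : 0 < ε) (hτ : 0 < τ) (hκ : (τ : EReal) < kappa (shiftedSpectrum A ε) ε)
    {s : EuclideanSpace ℝ (Fin d) →L[ℝ] EuclideanSpace ℝ (Fin d)} {x u : EuclideanSpace ℝ (Fin d)}
    (hu : ‖u‖ ≤ 1)
    (hb : ∀ t : ℝ, 0 ≤ t →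
      ‖s (NormedSpace.exp (t • (Matrix.toEuclideanCLM (𝕜 := ℝ) A + ε • 1)) x)‖ ≤ 1) :
    inner ℝ u (s (x + τ • Matrix.toEuclideanCLM (𝕜 := ℝ) A x)) < 1 := by
  set M := Matrix.toEuclideanCLM (𝕜 := ℝ) A + ε • 1 with hM
  set φ : EuclideanSpace ℝ (Fin d) →L[ℝ] ℝ := (innerSL ℝ u).comp s with hφ
  set p : ℝ → ℝ := fun t => φ (NormedSpace.exp (t • M) x) with hp
  set D : ℝ := φ (Matrix.toEuclideanCLM (𝕜 := ℝ) A x) with hD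
  have hp0 : p 0 = φ x := by
    simp only [hp]
    rw [exp_zero_smul_apply]
  have hder : HasDerivAt p (D + ε * p 0) 0 := by
    have := φ.hasFDerivAt.comp_hasDerivAt 0 (hasDerivAt_exp_smul_apply M x 0)
    rw [exp_zero_smul_apply] at this
    refine this.congr_deriv ?_
    rw [hp0, hM, add_apply, map_add, smul_apply, one_apply_eq_self, map_smul, smul_eq_mul]
  have hmem : p ∈ expPoly (shiftedSpectrum A ε) := by
    refine apply_exp_smul_mem_expPoly M φ _ x ?_
    have h1 : M = Matrix.toEuclideanCLM (𝕜 := ℝ) (A + ε • 1) := by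
      rw [hM, map_add, map_smul, map_one]
    rw [← (shiftedSpectrum_spec hA ε).1, h1, aeval_toEuclideanCLM_charpoly, zero_apply]
  have hbd : ∀ t, 0 ≤ t → |p t| ≤ 1 := fun t ht =>
    (abs_real_inner_le_norm _ _).trans (mul_le_one₀ hu (norm_nonneg _) (hb t ht))
  have hgoal : inner ℝ u (s (x + τ • Matrix.toEuclideanCLM (𝕜 := ℝ) A x)) = p 0 + τ * D := by
    change φ (x + τ • Matrix.toEuclideanCLM (𝕜 := ℝ) A x) = _
    rw [map_add, map_smul, hp0, smul_eq_mul]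
  rw [hgoal]
  -- Here `D = p'(0) - ε p(0)`. Only `D > 0` makes `p` a competitor for `κ`; for `D = 0`, `p(0) = 1`
  -- would make `p` maximal at `0` with `p'(0) = ε > 0`.
  rcases lt_trichotomy D 0 with hneg | hzero | hpos
  · have := le_of_abs_le (hbd 0 le_rfl)
    have := mul_neg_of_pos_of_neg hτ hneg
    linarith
  · rw [hzero, mul_zero, add_zero]
    exact lt_one_of_abs_le_one hε hder hbd (by linarith)
  · have h1 : kappa (shiftedSpectrum A ε) ε ≤
        (((1 - p 0) / (deriv p 0 - ε * p 0) : ℝ) : EReal) :=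
      sInf_le ⟨p, hmem, hbd, by rw [hder.deriv]; linarith, rfl⟩
    have h2 := EReal.coe_lt_coe_iff.1 (hκ.trans_le h1)
    rw [hder.deriv, add_sub_cancel_right, lt_div_iff₀ hpos] at h2
    linarith

theorem jointSpectralRadius_eulerFamily_lt_one {𝒜 : Set (Matrix (Fin d) (Fin d) ℝ)}
    (hcompact : IsCompact 𝒜) (hne : 𝒜.Nonempty) (hreal : ∀ A ∈ 𝒜, HasRealSpectrum A)
    {ε τ : ℝ} (hε : 0 < ε) (hτ : 0 < τ) (hσ : lyapunovExponent 𝒜 < ((-ε : ℝ) : EReal))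
    (hκ : ∀ A ∈ 𝒜, (τ : EReal) < kappa (shiftedSpectrum A ε) ε) :
    jointSpectralRadius (eulerFamily 𝒜 τ) < 1 := by
  obtain ⟨C, hC⟩ := exists_norm_le_of_mem_flowSemigroup hcompact hne hσ
  set S := (flowSemigroup 𝒜 ε).topologicalClosure with hS
  have hSC : ∀ s ∈ S, ‖s‖ ≤ C := fun s hs =>
    closure_minimal (t := {s | ‖s‖ ≤ C}) hC (isClosed_le continuous_norm continuous_const) hs
  have hScompact : IsCompact (S : Set (EuclideanSpace ℝ (Fin d) →L[ℝ] EuclideanSpace ℝ (Fin d))) := by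
    refine (isCompact_closedBall 0 C).of_isClosed_subset isClosed_closure fun s hs => ?_
    rw [mem_closedBall_zero_iff]
    exact hSC s hs
  -- The unit ball of the norm `sup_{s ∈ S} ‖s x‖`; it is bounded because `1 ∈ S`.
  set U : Set (EuclideanSpace ℝ (Fin d)) := {x | ∀ s ∈ S, ‖s x‖ ≤ 1} with hU
  have hUcompact : IsCompact U := by
    have hcl : IsClosed U := by
      have : U = ⋂ s ∈ S, {x | ‖s x‖ ≤ 1} := by
        ext x
        simp [hU]
      rw [this]
      exact isClosed_iInter fun s => isClosed_iInter fun _ =>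
        isClosed_le s.continuous.norm continuous_const
    refine (isCompact_closedBall 0 1).of_isClosed_subset hcl fun x hx => ?_
    rw [mem_closedBall_zero_iff]
    exact hx 1 (one_mem S)
  set g : Matrix (Fin d) (Fin d) ℝ × EuclideanSpace ℝ (Fin d) ×
      (EuclideanSpace ℝ (Fin d) →L[ℝ] EuclideanSpace ℝ (Fin d)) × EuclideanSpace ℝ (Fin d) → ℝ :=
    fun z => inner ℝ z.2.2.2
      (z.2.2.1 (z.2.1 + τ • Matrix.toEuclideanCLM (𝕜 := ℝ) z.1 z.2.1)) with hg
  have hgc : Continuous g := by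
    have h1 := (continuous_toEuclideanCLM (d := d)).comp (continuous_fst (X := Matrix (Fin d) (Fin d) ℝ)
      (Y := EuclideanSpace ℝ (Fin d) × (EuclideanSpace ℝ (Fin d) →L[ℝ] EuclideanSpace ℝ (Fin d)) ×
        EuclideanSpace ℝ (Fin d)))
    refine Continuous.inner (by fun_prop) (Continuous.clm_apply (by fun_prop) ?_)
    exact Continuous.add (by fun_prop) ((h1.clm_apply (by fun_prop)).const_smul τ)
  obtain ⟨A₀, hA₀⟩ := hne
  have h0U : (0 : EuclideanSpace ℝ (Fin d)) ∈ U := fun s _ => by simp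
  -- The pointwise strict inequality becomes uniform because the maximum over `A`, `x`, `s`, `u` is
  -- attained; this is why the semigroup was closed up.
  obtain ⟨⟨A₁, x₁, s₁, u₁⟩, ⟨hA₁, hx₁, hs₁, hu₁⟩, hmax⟩ :=
    (hcompact.prod (hUcompact.prod (hScompact.prod (isCompact_closedBall 0 1)))).exists_isMaxOn
      ⟨(A₀, 0, 1, 0), hA₀, h0U, one_mem S, by simp⟩ hgc.continuousOn
  set q := g (A₁, x₁, s₁, u₁) with hq
  have hq0 : 0 ≤ q := by
    have : g (A₀, 0, 1, 0) ≤ q := hmax ⟨hA₀, h0U, one_mem S, by simp⟩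
    simpa [hg] using this
  have hq1 : q < 1 := by
    refine inner_euler_lt_one (hreal _ hA₁) hε hτ (hκ _ hA₁) (mem_closedBall_zero_iff.1 hu₁)
      fun t ht => hx₁ (s₁ * NormedSpace.exp _) (mul_mem hs₁ ?_)
    exact Submonoid.le_topologicalClosure _ (Submonoid.subset_closure ⟨A₁, hA₁, t, ht, rfl⟩)
  -- The bound `‖s x‖ ≤ c` for all `s ∈ S` says that the invariant norm of `x` is at most `c`.
  have hstep : ∀ A ∈ 𝒜, ∀ (c : ℝ) (x : EuclideanSpace ℝ (Fin d)), (∀ s ∈ S, ‖s x‖ ≤ c) →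
      ∀ s ∈ S, ‖s (Matrix.toEuclideanCLM (𝕜 := ℝ) (1 + τ • A) x)‖ ≤ q * c := by
    intro A hA c x hx s hs
    have hc0 : 0 ≤ c := (norm_nonneg _).trans (hx 1 (one_mem S))
    rcases hc0.eq_or_lt with rfl | hc
    · have : x = 0 := norm_le_zero_iff.1 (hx 1 (one_mem S))
      simp [this]
    have hxU : c⁻¹ • x ∈ U := fun s hs => by
      rw [map_smul, norm_smul, norm_inv, Real.norm_of_nonneg hc.le]
      exact inv_mul_le_one_of_le₀ (hx s hs) hc.le
    have h1 : ‖s (c⁻¹ • x + τ • Matrix.toEuclideanCLM (𝕜 := ℝ) A (c⁻¹ • x))‖ ≤ q :=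
      norm_le_of_forall_inner_le hq0 fun u hu =>
        hmax (show (A, c⁻¹ • x, s, u) ∈ _ from ⟨hA, hxU, hs, mem_closedBall_zero_iff.2 hu⟩)
    have h2 : s (c⁻¹ • x + τ • Matrix.toEuclideanCLM (𝕜 := ℝ) A (c⁻¹ • x)) =
        c⁻¹ • s (Matrix.toEuclideanCLM (𝕜 := ℝ) (1 + τ • A) x) := by
      have h3 : Matrix.toEuclideanCLM (𝕜 := ℝ) (1 + τ • A) x =
          x + τ • Matrix.toEuclideanCLM (𝕜 := ℝ) A x := by
        rw [map_add, map_one, map_smul, add_apply, one_apply_eq_self, smul_apply]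
      rw [h3, ← s.map_smul, ContinuousLinearMap.map_smul (Matrix.toEuclideanCLM (𝕜 := ℝ) A),
        smul_add, smul_comm τ]
    rw [h2, norm_smul, norm_inv, Real.norm_of_nonneg hc.le, inv_mul_le_iff₀ hc, mul_comm] at h1
    exact h1
  have hlist : ∀ l : List (Matrix (Fin d) (Fin d) ℝ), (∀ B ∈ l, B ∈ eulerFamily 𝒜 τ) →
      ∀ (c : ℝ) (x : EuclideanSpace ℝ (Fin d)), (∀ s ∈ S, ‖s x‖ ≤ c) →
      ∀ s ∈ S, ‖s (Matrix.toEuclideanCLM (𝕜 := ℝ) l.prod x)‖ ≤ q ^ l.length * c := by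
    intro l
    induction l with
    | nil =>
      intro _ c x hx s hs
      simpa using hx s hs
    | cons B l ih =>
      intro hl c x hx
      obtain ⟨A, hA, rfl⟩ := hl B (by simp)
      rw [List.prod_cons, map_mul, List.length_cons, pow_succ', mul_assoc]
      exact hstep A hA _ _ (ih (fun B hB => hl B (by simp [hB])) c x hx)
  refine jointSpectralRadius_lt_one (K := C) hq0 hq1 fun l hl => ?_
  have hC0 : 0 ≤ C := (norm_nonneg _).trans (hSC 1 (one_mem S))
  refine ContinuousLinearMap.opNorm_le_bound _ (by positivity) fun x => ?_
  -- The invariant norm lies between `‖x‖` and `C ‖x‖`, so the contraction transfers to the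
  -- Euclidean norm with constant `C`.
  have := hlist l hl (C * ‖x‖) x (fun s hs => s.le_of_opNorm_le (hSC s hs) x) 1 (one_mem S)
  rw [one_apply_eq_self] at this
  linarith

end LSS

theorem proposition2 {d : ℕ} (𝒜 : Set (Matrix (Fin d) (Fin d) ℝ))
    (hcompact : IsCompact 𝒜) (hne : 𝒜.Nonempty)
    (hreal : ∀ A ∈ 𝒜, LSS.HasRealSpectrum A)
    (ε : ℝ) (hε : 0 < ε) :
    ∃ m : EReal,
      IsLeast ((fun A => LSS.kappa (LSS.shiftedSpectrum A ε) ε) '' 𝒜) m ∧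
        m ≤ LSS.maxStep 𝒜 ε := by
  obtain ⟨m, hm, hpos⟩ := LSS.exists_isLeast_kappa hcompact hne hreal hε
  refine ⟨m, hm, ?_⟩
  unfold LSS.maxStep
  split_ifs with hσ
  · exact le_top
  refine le_of_forall_lt fun c hc => ?_
  -- The step must be positive as well as above `c`; `m > 0` leaves room for this.
  obtain ⟨τ, hcτ, hτm⟩ := EReal.lt_iff_exists_real_btwn.1 (max_lt hc hpos)
  have hτ : 0 < τ := by exact_mod_cast (le_max_right c 0).trans_lt hcτ
  refine ((le_max_left c 0).trans_lt hcτ).trans_le (le_sSup ⟨τ, ⟨hτ, ?_⟩, rfl⟩)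
  exact LSS.jointSpectralRadius_eulerFamily_lt_one hcompact hne hreal hε hτ (not_le.1 hσ)
    fun A hA => hτm.trans_le (hm.2 ⟨A, hA, rfl⟩)
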